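/- \textbf{Setting.} Let $\Gamma$ be a finite extensive-form game with players $1,\dots,n$ and chance: a finite tree of nodes whose edges are labelled by actions, a set $\mathcal Z$ of terminal nodes, a partition of the decision nodes of each player $i$ into information sets (the same action set $A_I$ at all nodes of an information set $I$), probability distributions $p(\cdot\mid h)$ at chance nodes, and utilities $u_i:\mathcal Z\to[0,1]$. Let $T$ be the depth of the tree. The sequence $\sigma_i(h)$ is the list of the information sets of player $i$ passed, and of the actions taken there, on the path from the root to $h$, not including the information set of $h$. Assume perfect recall (for the player $i$ acting at $I$, $\sigma_i(h)$ is the same for all $h\in I$; it is denoted $\sigma(I)$), timeability (no information set spans several levels of the tree) and a fixed turn order (all non-terminal nodes of a level belong to the same player, or all to chance). Let $S$ be a finite set of messages containing, as pairwise distinct elements, the empty message $\bot$, all information sets and all actions. For each information set $I$ let $S_I\subseteq S$ be a set of legal messages with $\bot\in S_I$ and $I\in S_I$; write $\mathcal S=(S_I)_I$. A pure mediator strategy is a map $d:S^{\le T}\to S$; a mediator strategy is a probability distribution over pure mediator strategies. In the augmented game, a pure mediator strategy $d$ is drawn at the start and is not observed by the players. Whenever a player reaches a decision node, she observes her information set $I$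 and sends a message $s_t\in S_I$; she receives the reply $d(s_1,\dots,s_t)$, where $s_1,\dots,s_{t}$ are all messages sent so far by all players; then she chooses an action in $A_I$. The transcript with player $i$ is the list of the messages of $i$ and the replies to them. Pure strategies of player $i$ prescribe her message as a function of her information set and transcript, and her action as a function of her information set and the transcript including the current message and reply; mixed strategies are distributions over pure strategies, and the mediator's and all the players' draws are independent. An \emph{$\mathcal S$-certification equilibrium} is a mediator strategy together with mixed strategies of the players such that no player can raise her expected utility by changing only her own mixed strategy. Two such profiles are \emph{realization-equivalent} if for every $z\in\mathcal Z$ the probability that the mediator strategy and the pure strategies drawn play to $z$ (that is, the players choose every action of theirs on the path from the root to $z$) is the same under both; in particular they induce the same distribution over $\mathcal Z$. An $\mathcal S$-certification equilibrium is \emph{direct} if (1) every pure mediator strategy in the support of the mediator strategy has the following property: whenever player $i$ sends a message, if the message is an information set $I$ of player $i$ and the transcript with $i$ so far is exactly the sequence $\sigma(I)$, then the reply is an action in $A_I$, and otherwise the reply is $\bot$; and (2) every pure strategy in the support of each player's mixed strategy always reports the player's true information set $I$, and plays every action $a\in A_I$ that it receives as reply at $I$. \textbf{Proposition (revelation principle).}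 Assume that $\mathcal S$ satisfies the nested range condition: for all information sets $I,I'$, if $I\in S_{I'}$ then $S_I\subseteq S_{I'}$. Then for every $\mathcal S$-certification equilibrium there is a realization-equivalent direct $\mathcal S$-certification equilibrium. -/

import Mathlib

noncomputable section

namespace MediatedGame

/-- A finite extensive-form game with players `Fin n`, action labels in `A` and information sets
labelled by `Info`.  A node (history) is the list of the actions leading to it from the root `[]`,
the *latest action first*; so the child of `h` under the action `a` is `a :: h`. -/
structure ExtensiveGame (n : ℕ) (A Info : Type*) [Fintype A] where
  /-- the nodes of the tree -/
  hist : Finset (List A)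
  nil_mem : [] ∈ hist
  tail_mem : ∀ a h, a :: h ∈ hist → h ∈ hist
  /-- the information set of a non-terminal node; `none` at chance nodes -/
  infoset : List A → Option Info
  /-- the player to whom an information set belongs -/
  owner : Info → Fin n
  /-- information sets are the cells of a partition, so they are not empty -/
  infoset_nonempty : ∀ I, ∃ h ∈ hist, (∃ a, a :: h ∈ hist) ∧ infoset h = some I
  /-- the same actions are available at all nodes of an information set -/
  same_actions : ∀ I, ∀ h ∈ hist, ∀ h' ∈ hist, (∃ a, a :: h ∈ hist) → (∃ a, a :: h' ∈ hist) →
    infoset h = some I → infoset h' = some I → ∀ a, a :: h ∈ hist ↔ a :: h' ∈ hist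
  /-- the distribution over actions at chance nodes -/
  chance : List A → A → ℝ
  chance_nonneg : ∀ h ∈ hist, (∃ a, a :: h ∈ hist) → infoset h = none → ∀ a, 0 ≤ chance h a
  chance_support : ∀ h ∈ hist, (∃ a, a :: h ∈ hist) → infoset h = none →
    ∀ a, chance h a ≠ 0 → a :: h ∈ hist
  chance_sum : ∀ h ∈ hist, (∃ a, a :: h ∈ hist) → infoset h = none → ∑ a, chance h a = 1
  /-- the utility of each player at each terminal node -/
  utility : Fin n → List A → ℝ
  utility_mem : ∀ i, ∀ z ∈ hist, (∀ a, a :: z ∉ hist) → utility i z ∈ Set.Icc (0 : ℝ) 1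

namespace ExtensiveGame

variable {n : ℕ} {A Info : Type*} [Fintype A] (Γ : ExtensiveGame n A Info)

/-- `h` is a non-terminal node of the tree. -/
def Nonterminal (h : List A) : Prop := h ∈ Γ.hist ∧ ∃ a, a :: h ∈ Γ.hist

/-- The set of terminal nodes. -/
def terminals : Finset (List A) :=
  letI : DecidablePred fun z : List A => ∀ a, a :: z ∉ Γ.hist := Classical.decPred _
  Γ.hist.filter fun z => ∀ a, a :: z ∉ Γ.hist

/-- `h` is a (decision) node of the information set `I`. -/
def InInfoset (I : Info) (h : List A) : Prop := Γ.Nonterminal h ∧ Γ.infoset h = some I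

/-- The set `A_I` of actions available at the information set `I`. -/
def actionsAt (I : Info) : Set A := {a | ∃ h, Γ.InInfoset I h ∧ a :: h ∈ Γ.hist}

/-- The sequence `σ_i(h)`: the information sets of player `i` passed, and the actions taken there,
on the way to `h`, not including the information set of `h` itself (latest first). -/
def seq (i : Fin n) : List A → List (Info × A)
  | [] => []
  | a :: h =>
    match Γ.infoset h with
    | none => seq i h
    | some I => if Γ.owner I = i then (I, a) :: seq i h else seq i h

/-- `σ(I) = σ`: the player who acts at `I` has the sequence `σ` at every node of `I`. -/
def HasSeq (I : Info) (σ : List (Info × A)) : Prop :=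
  ∀ h, Γ.InInfoset I h → Γ.seq (Γ.owner I) h = σ

/-- Perfect recall: at all nodes of an information set the acting player has the same sequence. -/
def PerfectRecall : Prop := ∀ I, ∃ σ, Γ.HasSeq I σ

/-- Timeability: no information set spans several levels of the tree. -/
def Timeable : Prop := ∀ I h h', Γ.InInfoset I h → Γ.InInfoset I h' → h.length = h'.length

/-- The depth `T` of the tree. -/
def depth : ℕ := Γ.hist.sup List.length

/-- The product of the probabilities of all chance moves on the path to a node. -/
def chanceProb : List A → ℝ
  | [] => 1
  | a :: h =>
    match Γ.infoset h with
    | none => Γ.chance h a * chanceProb h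
    | some _ => chanceProb h

end ExtensiveGame

/-- An extensive-form game with perfect recall that is timeable and has a fixed turn order:
all non-terminal nodes of level `t` belong to the same player `turn t` (`none`: to chance). -/
structure TimedGame (n : ℕ) (A Info : Type*) [Fintype A] extends ExtensiveGame n A Info where
  turn : ℕ → Option (Fin n)
  turn_spec : ∀ h, toExtensiveGame.Nonterminal h →
    (toExtensiveGame.infoset h).map toExtensiveGame.owner = turn h.length
  perfectRecall : toExtensiveGame.PerfectRecall
  timeable : toExtensiveGame.Timeable

/-- The player who sends the message number `k` (counted from `0`) to the mediator; chance sends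
no messages. -/
def TimedGame.sender {n : ℕ} {A Info : Type*} [Fintype A] (Γ : TimedGame n A Info) (k : ℕ) :
    Option (Fin n) :=
  ((List.range Γ.depth).filterMap Γ.turn)[k]?

/-- A message space `S` together with the family of legal message sets.  The space contains,
through `code`, the empty message, all information sets and all actions; at each information set
the silent message and the honest message are legal. -/
structure MessageSystem (A Info S : Type*) where
  code : Option (Info ⊕ A) ↪ S
  /-- the messages that may be sent at an information set -/
  legal : Info → Set S
  bot_legal : ∀ I, code none ∈ legal I
  info_legal : ∀ I, code (some (Sum.inl I)) ∈ legal I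

namespace MessageSystem

variable {A Info S : Type*} (M : MessageSystem A Info S)

/-- the empty message `⊥` -/
def bot : S := M.code none

/-- the message that names an information set -/
def info (I : Info) : S := M.code (some (Sum.inl I))

/-- the message that names an action -/
def action (a : A) : S := M.code (some (Sum.inr a))

/-- The nested range condition: if `I` can be reported at `I'`, then all messages that are legal
at `I` are legal at `I'`. -/
def NestedRange : Prop := ∀ I I', M.info I ∈ M.legal I' → M.legal I ⊆ M.legal I'

end MessageSystem

/-- Lists of length at most `T`. -/
def ShortList (α : Type*) (T : ℕ) : Type _ := {l : List α // l.length ≤ T}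

instance {α : Type*} [Finite α] {T : ℕ} : Finite (ShortList α T) :=
  (List.finite_length_le α T).to_subtype

/-- A list as a `ShortList`; it is cut if it is too long, which does not happen in play. -/
def ShortList.ofList {α : Type*} {T : ℕ} (l : List α) : ShortList α T :=
  ⟨l.take T, List.length_take_le T l⟩

/-- A pure mediator strategy: the reply to each sequence of at most `T` messages (the messages of
all players, the latest first; the reply is sent to the sender of the latest message). -/
def PureMediator (S : Type*) (T : ℕ) : Type _ := ShortList S T → S

instance {S : Type*} [Finite S] {T : ℕ} : Finite (PureMediator S T) :=
  inferInstanceAs (Finite (ShortList S T → S))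

instance {S : Type*} [Finite S] {T : ℕ} : Fintype (PureMediator S T) := Fintype.ofFinite _

/-- The reply to the message sequence `l`. -/
def PureMediator.reply {S : Type*} {T : ℕ} (d : PureMediator S T) (l : List S) : S :=
  d (ShortList.ofList l)

section Play

variable {n : ℕ} {A Info S : Type*} [Fintype A] (Γ : TimedGame n A Info)
  (M : MessageSystem A Info S)

/-- The transcript with player `i` when all players together have sent the messages `l`: the list
of the pairs (message of `i`, reply of the mediator), the latest first. -/
def transcript (d : PureMediator S Γ.depth) (i : Fin n) : List S → List (S × S)
  | [] => []
  | s :: l =>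
    if Γ.sender l.length = some i then (s, d.reply (s :: l)) :: transcript d i l
    else transcript d i l

/-- A pure strategy of player `i` in the game augmented by a mediator.  By perfect recall, what
player `i` knows when she is to send a message is her information set and the transcript so far;
when she is to act, it is her information set and the transcript including the current message
and the reply to it. -/
@[ext]
structure PureStrategy (i : Fin n) where
  send : {I : Info // Γ.owner I = i} → ShortList (S × S) Γ.depth → S
  act : {I : Info // Γ.owner I = i} → ShortList (S × S) Γ.depth → A
  send_legal : ∀ I τ, send I τ ∈ M.legal I.1
  act_legal : ∀ I τ, act I τ ∈ Γ.actionsAt I.1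

instance [Finite Info] [Finite S] (i : Fin n) : Finite (PureStrategy Γ M i) :=
  Finite.of_injective
    (fun x : PureStrategy Γ M i => (x.send, x.act))
    (fun _ _ h => PureStrategy.ext (congrArg Prod.fst h) (congrArg Prod.snd h))

instance [Finite Info] [Finite S] (i : Fin n) : Fintype (PureStrategy Γ M i) := Fintype.ofFinite _

variable {Γ M}

/-- The messages sent on the path to a node, before that node is reached (the latest first), when
the players send messages according to `x` and the mediator replies according to `d`.  In
particular `messages d x (a :: h)` includes the message sent at `h`. -/
def messages (d : PureMediator S Γ.depth) (x : ∀ i, PureStrategy Γ M i) : List A → List S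
  | [] => []
  | _ :: h =>
    match Γ.infoset h with
    | none => messages d x h
    | some I =>
      (x (Γ.owner I)).send ⟨I, rfl⟩
        (ShortList.ofList (transcript Γ d (Γ.owner I) (messages d x h))) :: messages d x h

/-- The pure profile `x` plays to the node: with the mediator `d`, it plays every action of the
players on the path to that node. -/
def PlaysTo (d : PureMediator S Γ.depth) (x : ∀ i, PureStrategy Γ M i) : List A → Prop
  | [] => True
  | a :: h =>
    PlaysTo d x h ∧
      match Γ.infoset h with
      | none => True
      | some I =>
        (x (Γ.owner I)).act ⟨I, rfl⟩
          (ShortList.ofList (transcript Γ d (Γ.owner I) (messages d x (a :: h)))) = a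

variable [Fintype Info] [Fintype S]

variable (Γ M) in
/-- A randomized mediator strategy and a mixed strategy of each player, i.e. distributions over
the respective pure strategies. -/
structure Profile where
  mediator : stdSimplex ℝ (PureMediator S Γ.depth)
  player : ∀ i, stdSimplex ℝ (PureStrategy Γ M i)

namespace Profile

/-- The profile in which player `i` plays `y` instead, and all else is unchanged. -/
def deviate (e : Profile Γ M) (i : Fin n) (y : stdSimplex ℝ (PureStrategy Γ M i)) :
    Profile Γ M :=
  ⟨e.mediator, Function.update e.player i y⟩

open Classical in
/-- The realization form of a profile: the probability, when the mediator and the players draw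
their pure strategies independently, that the pure profile drawn plays to `z`. -/
def realization (e : Profile Γ M) (z : List A) : ℝ :=
  ∑ d : PureMediator S Γ.depth, ∑ x : ∀ i, PureStrategy Γ M i,
    e.mediator.1 d * (∏ i, (e.player i).1 (x i)) * (if PlaysTo d x z then 1 else 0)

/-- The expected utility of player `i`; the terminal node `z` is reached with probability
`chanceProb z * realization z`. -/
def expectedUtility (e : Profile Γ M) (i : Fin n) : ℝ :=
  ∑ z ∈ Γ.terminals, Γ.chanceProb z * e.realization z * Γ.utility i z

/-- Certification equilibrium: a Nash equilibrium of the game augmented by the mediator strategy,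
where the players are restricted to legal messages. -/
def IsCertificationEquilibrium (e : Profile Γ M) : Prop :=
  ∀ (i : Fin n) (y : stdSimplex ℝ (PureStrategy Γ M i)),
    (e.deviate i y).expectedUtility i ≤ e.expectedUtility i

/-- Two profiles are realization-equivalent if they have the same realization form on the
terminal nodes of the game. -/
def RealizationEquivalent (e e' : Profile Γ M) : Prop :=
  ∀ z ∈ Γ.terminals, e.realization z = e'.realization z

end Profile

variable (M) in
/-- After the messages `l`, player `i` makes a valid report of `I` by sending `s`: `I` is an
information set of player `i`, `s` names it, and the transcript with player `i` is exactly the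
sequence `σ(I)`. -/
def ValidReport (d : PureMediator S Γ.depth) (i : Fin n) (l : List S) (s : S) (I : Info) : Prop :=
  Γ.owner I = i ∧ s = M.info I ∧
    ∃ σ, Γ.HasSeq I σ ∧ transcript Γ d i l = σ.map fun p => (M.info p.1, M.action p.2)

variable (M) in
/-- Mediator directness: the reply to a valid report of `I` is an action of `A_I`, and the reply
to any other message is `⊥`. -/
def DirectMediator (d : PureMediator S Γ.depth) : Prop :=
  ∀ (l : List S) (s : S) (i : Fin n), (s :: l).length ≤ Γ.depth → Γ.sender l.length = some i →
    (∀ I, ValidReport M d i l s I → ∃ a ∈ Γ.actionsAt I, d.reply (s :: l) = M.action a) ∧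
    ((∀ I, ¬ ValidReport M d i l s I) → d.reply (s :: l) = M.bot)

/-- Player directness: always report the true information set, and play each action of `A_I`
that is received at `I`. -/
def DirectStrategy {i : Fin n} (x : PureStrategy Γ M i) : Prop :=
  (∀ I τ, x.send I τ = M.info I.1) ∧
    ∀ I (τ : ShortList (S × S) Γ.depth) (τ₀ : List (S × S)) (s : S), ∀ a ∈ Γ.actionsAt I.1,
      τ.1 = (s, M.action a) :: τ₀ → x.act I τ = a

/-- A direct equilibrium: a certification equilibrium in which the mediator and all players use
direct strategies only. -/
def Profile.IsDirectEquilibrium (e : Profile Γ M) : Prop :=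
  e.IsCertificationEquilibrium ∧
    (∀ d, e.mediator.1 d ≠ 0 → DirectMediator M d) ∧
    ∀ i x, (e.player i).1 x ≠ 0 → DirectStrategy x

end Play

end MediatedGame

end

noncomputable section

namespace MediatedGame

/-! The new mediator draws `d` and a whole profile `x` as in the given equilibrium and runs `x` on
the players' behalf. A valid report of `I` makes it send to `d` what `x i` would send at `I` and
recommend what `x i` would then do; any other message is passed on as `⊥` and answered by `⊥`. With
honest, obedient players, play for fixed `(d, x)` is that of `x` against `d`, so moving the draw of
`x` into the mediator preserves the realization form (`realization_direct`).

For incentives, a deviation `y` of player `i` is carried back to the original game: she draws `x i`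
herself and performs the mediator's part of the simulation between `y` and `d` (`relayedStrategy`).
By perfect recall her information set and transcript determine what is needed to do so. The result
is legal by the nested range condition: a report of `I` that is legal at `I'` triggers a message
from `S_I ⊆ S_{I'}` (`relayedMessage_legal`). Both games then have the same realization form
(`realization_direct_deviate`), so a profitable deviation from the direct profile would give one
from the original equilibrium.

Both comparisons are instances of one induction along the path, `playsTo_directMediator_aux`, with
the two cases of a player abstracted by `Simulates`. -/

open Classical in
/-- The image of a distribution under a map. -/
def pushforward {α β : Type*} [Fintype α] (p : α → ℝ) (f : α → β) (b : β) : ℝ :=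
  ∑ a, if f a = b then p a else 0

/-! ### Pushforwards and product distributions -/

section Sums

variable {α β : Type*} [Fintype α]

lemma exists_of_pushforward_ne_zero {p : α → ℝ} {f : α → β} {b : β}
    (h : pushforward p f b ≠ 0) : ∃ a, f a = b := by
  obtain ⟨a, -, ha⟩ := Finset.exists_ne_zero_of_sum_ne_zero h
  exact ⟨a, by_contra fun hab => ha (if_neg hab)⟩

variable [Fintype β]

lemma sum_pushforward_mul (p : α → ℝ) (f : α → β) (g : β → ℝ) :
    ∑ b, pushforward p f b * g b = ∑ a, p a * g (f a) := by
  classical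
  simp only [pushforward, Finset.sum_mul]
  rw [Finset.sum_comm]
  refine Finset.sum_congr rfl fun a _ => ?_
  simp [ite_mul]

lemma pushforward_mem_stdSimplex {p : α → ℝ} (hp : p ∈ stdSimplex ℝ α) (f : α → β) :
    pushforward p f ∈ stdSimplex ℝ β := by
  refine ⟨fun b => Finset.sum_nonneg fun a _ => ?_, ?_⟩
  · split_ifs
    exacts [hp.1 a, le_rfl]
  · simpa [hp.2] using sum_pushforward_mul p f fun _ => 1

lemma mul_mem_stdSimplex {p : α → ℝ} {q : β → ℝ} (hp : p ∈ stdSimplex ℝ α)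
    (hq : q ∈ stdSimplex ℝ β) : (fun c : α × β => p c.1 * q c.2) ∈ stdSimplex ℝ (α × β) := by
  refine ⟨fun c => mul_nonneg (hp.1 _) (hq.1 _), ?_⟩
  rw [Fintype.sum_prod_type]
  simp [← Finset.mul_sum, hp.2, hq.2]

variable {ι : Type*} [Fintype ι] [DecidableEq ι] {κ : ι → Type*} [∀ i, Fintype (κ i)]

lemma prod_mem_stdSimplex {p : ∀ i, κ i → ℝ} (hp : ∀ i, p i ∈ stdSimplex ℝ (κ i)) :
    (fun x : ∀ i, κ i => ∏ i, p i (x i)) ∈ stdSimplex ℝ (∀ i, κ i) := by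
  refine ⟨fun x => Finset.prod_nonneg fun i _ => (hp i).1 _, ?_⟩
  rw [← Fintype.prod_sum]
  simp [(hp _).2]

/-- In a product distribution one factor may be replaced by drawing its coordinate anew. -/
lemma sum_prod_update (p : ∀ i, κ i → ℝ) (i : ι) (hp : ∑ b, p i b = 1) (q : κ i → ℝ)
    (g : (∀ i, κ i) → ℝ) :
    ∑ x, (∏ j, Function.update p i q j (x j)) * g x
      = ∑ x, (∏ j, p j (x j)) * ∑ b, q b * g (Function.update x i b) := by
  -- Split coordinate `i` off. Once the update overwrites it, its old weight `p i` sums to one.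
  have key : ∀ (r : κ i → ℝ) (f : (∀ i, κ i) → ℝ),
      ∑ x, (∏ j, Function.update p i r j (x j)) * f x
        = ∑ y : ∀ j : {j // j ≠ i}, κ j, ∑ b, r b * (∏ j, p j.1 (y j)) *
            f ((Equiv.piSplitAt i κ).symm (b, y)) := by
    intro r f
    rw [← (Equiv.piSplitAt i κ).symm.sum_comp, Fintype.sum_prod_type, Finset.sum_comm]
    refine Finset.sum_congr rfl fun y _ => Finset.sum_congr rfl fun b _ => ?_
    congr 1
    rw [Fintype.prod_eq_mul_prod_subtype_ne _ i]
    congr 1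
    · simp [Equiv.piSplitAt]
    · refine Finset.prod_congr rfl fun j _ => ?_
      simp [Equiv.piSplitAt, j.2]
  rw [key]
  conv_rhs => rw [← Function.update_eq_self i p]
  rw [key]
  refine Finset.sum_congr rfl fun y _ => ?_
  have hu : ∀ b c, Function.update ((Equiv.piSplitAt i κ).symm (b, y)) i c
      = (Equiv.piSplitAt i κ).symm (c, y) := by
    intro b c
    ext j
    by_cases hj : j = i
    · subst hj
      simp [Equiv.piSplitAt]
    · simp [Equiv.piSplitAt, hj]
  simp only [hu, mul_assoc, ← Finset.sum_mul, hp, one_mul]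
  rw [Finset.mul_sum]
  exact Finset.sum_congr rfl fun b _ => by ring

lemma sum_prod_single [∀ i, DecidableEq (κ i)] (x₀ : ∀ i, κ i) (g : (∀ i, κ i) → ℝ) :
    ∑ x, (∏ j, (Pi.single (x₀ j) 1 : κ j → ℝ) (x j)) * g x = g x₀ := by
  rw [Finset.sum_eq_single x₀]
  · simp
  · intro x _ hx
    obtain ⟨j, hj⟩ := Function.ne_iff.1 hx
    rw [Finset.prod_eq_zero (Finset.mem_univ j), zero_mul]
    simp [hj]
  · simp

end Sums

lemma ShortList.val_ofList {α : Type*} {T : ℕ} {l : List α} (h : l.length ≤ T) :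
    (ShortList.ofList l : ShortList α T).1 = l :=
  List.take_of_length_le h

namespace MessageSystem

variable {A Info S : Type*}

lemma info_injective (M : MessageSystem A Info S) : Function.Injective M.info := fun I J h => by
  simpa using M.code.injective h

lemma action_injective (M : MessageSystem A Info S) : Function.Injective M.action :=
  fun a b h => by simpa using M.code.injective h

end MessageSystem

variable {n : ℕ} {A Info S : Type*} [Fintype A] {Γ : TimedGame n A Info}
  {M : MessageSystem A Info S}

namespace TimedGame

lemma actionsAt_nonempty (Γ : TimedGame n A Info) (I : Info) : (Γ.actionsAt I).Nonempty := by
  obtain ⟨h, hh, ⟨a, ha⟩, hI⟩ := Γ.infoset_nonempty I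
  exact ⟨a, h, ⟨⟨hh, a, ha⟩, hI⟩, ha⟩

/-- The sequence `σ(I)` of the player who acts at `I`. -/
def infoSeq (Γ : TimedGame n A Info) (I : Info) : List (Info × A) := (Γ.perfectRecall I).choose

/-- Uniqueness rests on `I` having a node; at an empty cell every `σ` would qualify. -/
lemma hasSeq_iff {I : Info} {σ : List (Info × A)} : Γ.HasSeq I σ ↔ σ = Γ.infoSeq I := by
  have hs := (Γ.perfectRecall I).choose_spec
  refine ⟨fun h => ?_, fun h => h ▸ hs⟩
  obtain ⟨v, hv, ha, hI⟩ := Γ.infoset_nonempty I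
  exact (h v ⟨⟨hv, ha⟩, hI⟩).symm.trans (hs v ⟨⟨hv, ha⟩, hI⟩)

lemma seq_eq_infoSeq {I : Info} {h : List A} (hI : Γ.InInfoset I h) :
    Γ.seq (Γ.owner I) h = Γ.infoSeq I :=
  (Γ.perfectRecall I).choose_spec h hI

lemma mem_hist_of_mem_terminals {z : List A} (hz : z ∈ Γ.terminals) : z ∈ Γ.hist :=
  @Finset.filter_subset _ _ (_) _ _ hz

lemma length_le_depth {h : List A} (hh : h ∈ Γ.hist) : h.length ≤ Γ.depth :=
  Finset.le_sup (f := List.length) hh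

end TimedGame

/-! ### Messages along a path and the turn order -/

section Messages

variable (d : PureMediator S Γ.depth) (x : ∀ i, PureStrategy Γ M i)

lemma length_transcript_le (i : Fin n) (l : List S) : (transcript Γ d i l).length ≤ l.length := by
  induction l with
  | nil => simp [transcript]
  | cons s l ih =>
    rw [transcript]
    split_ifs <;> simp <;> omega

lemma messages_cons_none {a : A} {h : List A} (hI : Γ.infoset h = none) :
    messages d x (a :: h) = messages d x h := by
  rw [messages]
  split
  · rfl
  · simp_all

lemma messages_cons_some {a : A} {h : List A} {I : Info} (hI : Γ.infoset h = some I) :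
    messages d x (a :: h) = (x (Γ.owner I)).send ⟨I, rfl⟩
      (ShortList.ofList (transcript Γ d (Γ.owner I) (messages d x h))) :: messages d x h := by
  rw [messages]
  split
  · simp_all
  · rename_i J hJ
    obtain rfl : J = I := by simpa [hJ] using hI
    rfl

lemma playsTo_cons_none {a : A} {h : List A} (hI : Γ.infoset h = none) :
    PlaysTo d x (a :: h) ↔ PlaysTo d x h := by
  rw [PlaysTo]
  split
  · simp
  · simp_all

lemma playsTo_cons_some {a : A} {h : List A} {I : Info} (hI : Γ.infoset h = some I) :
    PlaysTo d x (a :: h) ↔ PlaysTo d x h ∧ (x (Γ.owner I)).act ⟨I, rfl⟩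
      (ShortList.ofList (transcript Γ d (Γ.owner I) (messages d x (a :: h)))) = a := by
  rw [PlaysTo]
  split
  · simp_all
  · rename_i J hJ
    obtain rfl : J = I := by simpa [hJ] using hI
    rfl

lemma length_messages {h : List A} (hh : h ∈ Γ.hist) :
    (messages d x h).length = ((List.range h.length).filterMap Γ.turn).length := by
  induction h with
  | nil => simp [messages]
  | cons a h ih =>
    have hh' := Γ.tail_mem a h hh
    have ht := Γ.turn_spec h ⟨hh', a, hh⟩
    rw [List.length_cons, List.range_succ, List.filterMap_append, List.length_append, ← ih hh']
    rcases hI : Γ.infoset h with _ | I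
    · rw [messages_cons_none d x hI]
      rw [hI] at ht
      simp [← ht]
    · rw [messages_cons_some d x hI]
      rw [hI] at ht
      simp [← ht]

lemma length_messages_le {h : List A} (hh : h ∈ Γ.hist) :
    (messages d x h).length ≤ Γ.depth := by
  rw [length_messages d x hh]
  refine (List.length_filterMap_le _ _).trans ?_
  simpa using TimedGame.length_le_depth hh

/-- By the fixed turn order, the number of messages sent depends only on the level, so the index of
a message identifies its sender. -/
lemma sender_length_messages {h : List A} {I : Info} (hI : Γ.InInfoset I h) :
    Γ.sender (messages d x h).length = some (Γ.owner I) := by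
  obtain ⟨⟨hh, a, ha⟩, hI'⟩ := hI
  have ht := Γ.turn_spec h ⟨hh, a, ha⟩
  rw [hI', Option.map_some] at ht
  -- `h` has a child, so its level is among those that `sender` lists.
  have hlt : h.length + 1 ≤ Γ.depth := by
    simpa using TimedGame.length_le_depth ha
  obtain ⟨k, hk⟩ := Nat.exists_eq_add_of_le hlt
  rw [length_messages d x hh, TimedGame.sender, hk, List.range_add, List.range_succ]
  simp [List.filterMap_append, ← ht]

end Messages

/-! ### Relaying one report to the simulated strategy -/

section Relay

/-- After the direct transcript `δ` with player `i`, the message `s` is a valid report of `I`. -/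
def IsReport (M : MessageSystem A Info S) {i : Fin n} (δ : List (S × S)) (s : S)
    (I : {I : Info // Γ.owner I = i}) : Prop :=
  s = M.info I.1 ∧ δ = (Γ.infoSeq I.1).map fun p => (M.info p.1, M.action p.2)

lemma IsReport.unique {i : Fin n} {δ : List (S × S)} {s : S} {I J : {I : Info // Γ.owner I = i}}
    (hI : IsReport M δ s I) (hJ : IsReport M δ s J) : I = J :=
  Subtype.ext (M.info_injective (hI.1.symm.trans hJ.1))

variable {i : Fin n} (x : PureStrategy Γ M i) (δ : List (S × S)) (s : S) (τ : List (S × S))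

open Classical in
/-- The message sent on behalf of a player who reports `s` after the direct transcript `δ`, when
`τ` is the transcript of the messages sent on her behalf and the replies to them. -/
def relayedMessage : S :=
  if h : ∃ I, IsReport (Γ := Γ) (i := i) M δ s I then x.send h.choose (ShortList.ofList τ)
  else M.bot

open Classical in
/-- The reply to a player who reports `s` after the direct transcript `δ`, when `τ` is the
transcript of the messages sent on her behalf, including the current one. -/
def relayedReply : S :=
  if h : ∃ I, IsReport (Γ := Γ) (i := i) M δ s I then
    M.action (x.act h.choose (ShortList.ofList τ))
  else M.bot

variable {δ s}

lemma relayedMessage_of_isReport {I : {I : Info // Γ.owner I = i}} (h : IsReport M δ s I) :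
    relayedMessage x δ s τ = x.send I (ShortList.ofList τ) := by
  have hI : ∃ I, IsReport (Γ := Γ) (i := i) M δ s I := ⟨I, h⟩
  rw [relayedMessage, dif_pos hI, hI.choose_spec.unique h]

lemma relayedReply_of_isReport {I : {I : Info // Γ.owner I = i}} (h : IsReport M δ s I) :
    relayedReply x δ s τ = M.action (x.act I (ShortList.ofList τ)) := by
  have hI : ∃ I, IsReport (Γ := Γ) (i := i) M δ s I := ⟨I, h⟩
  rw [relayedReply, dif_pos hI, hI.choose_spec.unique h]

lemma relayedReply_of_not_isReport (h : ∀ I, ¬ IsReport (Γ := Γ) (i := i) M δ s I) :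
    relayedReply x δ s τ = M.bot := by
  rw [relayedReply, dif_neg (not_exists.2 h)]

/-- This is where the nested range condition enters: the relayed message is legal at the reported
information set, hence at the true one. -/
lemma relayedMessage_legal (hM : M.NestedRange) {I : Info} (hs : s ∈ M.legal I) :
    relayedMessage x δ s τ ∈ M.legal I := by
  rw [relayedMessage]
  split_ifs with h
  · have hr := h.choose_spec.1
    rw [hr] at hs
    exact hM _ _ hs (x.send_legal _ _)
  · exact M.bot_legal I

end Relay

/-! ### The simulating mediator and its directness -/

section DirectMediator

variable (d : PureMediator S Γ.depth) (x : ∀ i, PureStrategy Γ M i)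

/-- The messages sent to `d` by `x` on behalf of the players, and the direct transcripts of the
players, when they report `l`. -/
def simulation : List S → List S × (Fin n → List (S × S))
  | [] => ([], fun _ => [])
  | s :: l =>
    match Γ.sender l.length with
    -- There is no sender only past the last player level. The filler keeps the simulated list as
    -- long as the reported one, so both assign the same sender to each index.
    | none => (M.bot :: (simulation l).1, (simulation l).2)
    | some i =>
      let m := relayedMessage (x i) ((simulation l).2 i) s (transcript Γ d i (simulation l).1)
      (m :: (simulation l).1,
        Function.update (simulation l).2 i
          ((s, relayedReply (x i) ((simulation l).2 i) s
            (transcript Γ d i (m :: (simulation l).1))) :: (simulation l).2 i))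

/-- The mediator that simulates the strategies `x` and the mediator `d`. -/
def directMediator : PureMediator S Γ.depth := fun l =>
  match l.1 with
  | [] => M.bot
  | s :: l =>
    match Γ.sender l.length with
    | none => M.bot
    | some i =>
      relayedReply (x i) ((simulation d x l).2 i) s
        (transcript Γ d i (simulation d x (s :: l)).1)

variable {i : Fin n} {l : List S}

lemma simulation_cons_fst (hi : Γ.sender l.length = some i) (s : S) :
    (simulation d x (s :: l)).1 = relayedMessage (x i) ((simulation d x l).2 i) s
      (transcript Γ d i (simulation d x l).1) :: (simulation d x l).1 := by
  rw [simulation]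
  split
  · simp_all
  · rename_i j hj
    obtain rfl : j = i := by simpa [hj] using hi
    rfl

lemma directMediator_reply (hi : Γ.sender l.length = some i) {s : S}
    (hl : (s :: l).length ≤ Γ.depth) :
    (directMediator d x).reply (s :: l) = relayedReply (x i) ((simulation d x l).2 i) s
      (transcript Γ d i (simulation d x (s :: l)).1) := by
  rw [PureMediator.reply, directMediator]
  simp only [ShortList.val_ofList hl]
  split
  · simp_all
  · rename_i j hj
    obtain rfl : j = i := by simpa [hj] using hi
    rfl

/-- Justifies the bookkeeping in `simulation`: validity judged there is validity for the actual
transcript. The length bound rules out truncation in `reply`. -/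
lemma transcript_directMediator (j : Fin n) (l : List S) (hl : l.length ≤ Γ.depth) :
    transcript Γ (directMediator d x) j l = (simulation d x l).2 j := by
  induction l with
  | nil => simp [transcript, simulation]
  | cons s l ih =>
    have ih := ih ((Nat.le_succ _).trans hl)
    rcases hi : Γ.sender l.length with _ | i
    · rw [transcript, simulation, hi]
      simpa using ih
    · rw [transcript, directMediator_reply d x hi hl, simulation_cons_fst d x hi, simulation, hi, ih]
      by_cases hj : i = j
      · subst hj
        simp
      · simp [hj, Ne.symm hj]

lemma validReport_iff (hl : l.length ≤ Γ.depth) {s : S} {I : Info} :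
    ValidReport M (directMediator d x) i l s I ↔
      ∃ h : Γ.owner I = i, IsReport M ((simulation d x l).2 i) s ⟨I, h⟩ := by
  simp only [ValidReport, IsReport, TimedGame.hasSeq_iff, transcript_directMediator d x i l hl,
    exists_eq_left, exists_prop]

lemma directMediator_direct : DirectMediator M (directMediator d x) := by
  intro l s i hl hi
  have hl' : l.length ≤ Γ.depth := (Nat.le_succ _).trans hl
  simp only [validReport_iff d x hl', directMediator_reply d x hi hl]
  constructor
  · rintro I ⟨rfl, hI⟩
    exact ⟨_, (x _).act_legal ⟨I, rfl⟩ _, relayedReply_of_isReport _ _ hI⟩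
  · intro h
    exact relayedReply_of_not_isReport _ _ fun I hI => h I.1 ⟨I.2, hI⟩

end DirectMediator

/-! ### Equivalence of direct and original play -/

section Simulates

/-- In any play, the player who uses `w` in the direct game makes the same moves as the player who
uses `v` in the original game, when the direct mediator simulates `x`.  The function `R` recovers
the direct transcript from the sequence of the player and from the simulated transcript. -/
structure Simulates {i : Fin n} (x w v : PureStrategy Γ M i)
    (R : List (Info × A) → List (S × S) → List (S × S)) : Prop where
  nil : R [] [] = []
  send : ∀ (I : {I : Info // Γ.owner I = i}) (τ : List (S × S)), τ.length ≤ Γ.depth →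
    v.send I (ShortList.ofList τ) = relayedMessage x (R (Γ.infoSeq I.1) τ)
      (w.send I (ShortList.ofList (R (Γ.infoSeq I.1) τ))) τ
  act : ∀ (I : {I : Info // Γ.owner I = i}) (p : S × S) (τ : List (S × S)),
    (p :: τ).length ≤ Γ.depth →
    w.act I (ShortList.ofList ((w.send I (ShortList.ofList (R (Γ.infoSeq I.1) τ)),
      relayedReply x (R (Γ.infoSeq I.1) τ)
        (w.send I (ShortList.ofList (R (Γ.infoSeq I.1) τ))) (p :: τ)) :: R (Γ.infoSeq I.1) τ))
      = v.act I (ShortList.ofList (p :: τ))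
  cons : ∀ (I : {I : Info // Γ.owner I = i}) (p : S × S) (τ : List (S × S)),
    (p :: τ).length ≤ Γ.depth →
    R ((I.1, v.act I (ShortList.ofList (p :: τ))) :: Γ.infoSeq I.1) (p :: τ)
      = (w.send I (ShortList.ofList (R (Γ.infoSeq I.1) τ)),
        relayedReply x (R (Γ.infoSeq I.1) τ)
          (w.send I (ShortList.ofList (R (Γ.infoSeq I.1) τ))) (p :: τ)) :: R (Γ.infoSeq I.1) τ

variable (d : PureMediator S Γ.depth) {x w v : ∀ i, PureStrategy Γ M i}
  {R : Fin n → List (Info × A) → List (S × S) → List (S × S)}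

/-- The claim about play cannot be proved alone: equal actions need equal transcripts. The induction
therefore also carries that `d` receives the same messages and that `R` recovers each direct
transcript. -/
lemma playsTo_directMediator_aux (hR : ∀ i, Simulates (x i) (w i) (v i) (R i)) (h : List A)
    (hh : h ∈ Γ.hist) :
    (PlaysTo (directMediator d x) w h ↔ PlaysTo d v h) ∧
      (PlaysTo d v h →
        (simulation d x (messages (directMediator d x) w h)).1 = messages d v h ∧
        ∀ j, (simulation d x (messages (directMediator d x) w h)).2 j
          = R j (Γ.seq j h) (transcript Γ d j (messages d v h))) := by
  induction h with
  | nil => simp [PlaysTo, messages, simulation, ExtensiveGame.seq, transcript, (hR _).nil]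
  | cons a h ih =>
    have hh' := Γ.tail_mem a h hh
    obtain ⟨ih₁, ih₂⟩ := ih hh'
    rcases hI : Γ.infoset h with _ | I
    · simp only [playsTo_cons_none _ _ hI, messages_cons_none _ _ hI, ExtensiveGame.seq, hI]
      exact ⟨ih₁, ih₂⟩
    have hin : Γ.InInfoset I h := ⟨⟨hh', a, hh⟩, hI⟩
    rw [playsTo_cons_some _ _ hI, playsTo_cons_some _ _ hI, ih₁]
    by_cases hp : PlaysTo d v h
    swap
    · simp [hp]
    obtain ⟨hsim, htr⟩ := ih₂ hp
    have hlenD := length_messages_le (directMediator d x) w hh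
    have hlen := length_messages_le d v hh
    rw [messages_cons_some _ _ hI] at hlenD hlen
    rw [messages_cons_some _ _ hI, messages_cons_some _ _ hI]
    have hsD := sender_length_messages (directMediator d x) w hin
    have hs := sender_length_messages d v hin
    set lD := messages (directMediator d x) w h with hlD
    set l := messages d v h with hl
    have hlD' : lD.length ≤ Γ.depth := (Nat.le_succ _).trans hlenD
    have hl' : l.length ≤ Γ.depth := (Nat.le_succ _).trans hlen
    have hτ := (length_transcript_le d (Γ.owner I) l).trans hl'
    have hδ := htr (Γ.owner I)
    rw [TimedGame.seq_eq_infoSeq hin] at hδ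
    set τ := transcript Γ d (Γ.owner I) l with hτdef
    have hsend := (hR (Γ.owner I)).send ⟨I, rfl⟩ τ hτ
    have htD := transcript_directMediator d x (Γ.owner I) lD hlD'
    rw [hδ] at htD
    simp only [htD]
    set δ := R (Γ.owner I) (Γ.infoSeq I) τ with hδdef
    set s := (w (Γ.owner I)).send ⟨I, rfl⟩ (ShortList.ofList δ) with hsdef
    set m := (v (Γ.owner I)).send ⟨I, rfl⟩ (ShortList.ofList τ) with hmdef
    rw [htD, ← hsdef] at hlenD
    have hsim' : (simulation d x (s :: lD)).1 = m :: l := by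
      rw [simulation_cons_fst d x hsD, hsim, hδ, hsend]
    have hτ' : transcript Γ d (Γ.owner I) (m :: l) = (m, d.reply (m :: l)) :: τ := by
      rw [transcript, if_pos hs]
    have hτlen : ((m, d.reply (m :: l)) :: τ).length ≤ Γ.depth := by
      rw [← hτ']
      exact (length_transcript_le d _ _).trans hlen
    have hδ' : (simulation d x (s :: lD)).2 (Γ.owner I)
        = (s, relayedReply (x (Γ.owner I)) δ s ((m, d.reply (m :: l)) :: τ)) :: δ := by
      rw [← transcript_directMediator d x _ _ hlenD, transcript, if_pos hsD,
        directMediator_reply d x hsD hlenD, hsim', hτ', htD, hδ]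
    have hact := (hR (Γ.owner I)).act ⟨I, rfl⟩ _ τ hτlen
    have hcons := (hR (Γ.owner I)).cons ⟨I, rfl⟩ _ τ hτlen
    rw [transcript_directMediator d x _ _ hlenD, hδ', hτ']
    refine ⟨by rw [hact], ?_⟩
    rintro ⟨-, ha⟩
    refine ⟨hsim', fun j => ?_⟩
    simp only [ExtensiveGame.seq, hI]
    by_cases hj : Γ.owner I = j
    · subst hj
      -- The sequence records the action on the path, whereas `cons` speaks of the action of `v`;
      -- `ha` identifies them. Hence the invariant is asserted only along played paths.
      rw [if_pos rfl, hδ', hτ', TimedGame.seq_eq_infoSeq hin, ← hcons, ha]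
    · have hj' : ¬ some (Γ.owner I) = some j := by simpa using hj
      rw [if_neg hj, ← transcript_directMediator d x _ _ hlenD, transcript, transcript, hsD, hs,
        if_neg hj', if_neg hj', transcript_directMediator d x _ _ hlD', htr j]

lemma playsTo_directMediator_iff (hR : ∀ i, ∃ R, Simulates (x i) (w i) (v i) R) {h : List A}
    (hh : h ∈ Γ.hist) : PlaysTo (directMediator d x) w h ↔ PlaysTo d v h := by
  choose R hR using hR
  exact (playsTo_directMediator_aux d hR h hh).1

end Simulates

/-! ### Honest play and relayed deviations -/

section Strategies

open Classical in
variable (Γ M) in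
/-- The strategy that reports the true information set and obeys the mediator. -/
def directStrategy (i : Fin n) : PureStrategy Γ M i where
  send I _ := M.info I.1
  act I τ :=
    if h : ∃ a ∈ Γ.actionsAt I.1, ∃ s τ₀, τ.1 = (s, M.action a) :: τ₀ then h.choose
    else (Γ.actionsAt_nonempty I.1).some
  send_legal I _ := M.info_legal I.1
  act_legal I τ := by
    split_ifs with h
    · exact h.choose_spec.1
    · exact (Γ.actionsAt_nonempty I.1).some_mem

lemma directStrategy_direct (i : Fin n) : DirectStrategy (directStrategy Γ M i) := by
  refine ⟨fun _ _ => rfl, fun I τ τ₀ s a ha h => ?_⟩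
  have hex : ∃ a ∈ Γ.actionsAt I.1, ∃ s τ₀, τ.1 = (s, M.action a) :: τ₀ := ⟨a, ha, s, τ₀, h⟩
  simp only [directStrategy, dif_pos hex]
  obtain ⟨-, s', τ', h'⟩ := hex.choose_spec
  have heq := h.symm.trans h'
  rw [List.cons.injEq, Prod.mk.injEq] at heq
  exact M.action_injective heq.1.2.symm

/-- For an honest, obedient player the direct transcript is the coded sequence itself, so every
report is valid and `x` is relayed unchanged; `R` can ignore the simulated transcript. -/
lemma simulates_directStrategy {i : Fin n} (x : PureStrategy Γ M i) :
    Simulates x (directStrategy Γ M i) x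
      fun σ _ => σ.map fun p => (M.info p.1, M.action p.2) := by
  have hrep : ∀ I : {I : Info // Γ.owner I = i}, IsReport M
      ((Γ.infoSeq I.1).map fun p => (M.info p.1, M.action p.2)) (M.info I.1) I :=
    fun I => ⟨rfl, rfl⟩
  have hsend : ∀ I τ, (directStrategy Γ M i).send I τ = M.info I.1 := fun _ _ => rfl
  refine ⟨rfl, fun I τ _ => ?_, fun I p τ hl => ?_, fun I p τ _ => ?_⟩
  · rw [hsend, relayedMessage_of_isReport x τ (hrep I)]
  · rw [hsend, relayedReply_of_isReport x _ (hrep I)]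
    -- With positive depth, truncation keeps the newest entry, the only one an obedient player
    -- reads.
    obtain ⟨k, hk⟩ := Nat.exists_eq_add_of_le' (show 1 ≤ Γ.depth by simp at hl; omega)
    refine (directStrategy_direct i).2 I _ (((Γ.infoSeq I.1).map fun p =>
      (M.info p.1, M.action p.2)).take k) (M.info I.1) _ (x.act_legal I _) ?_
    simp only [ShortList.ofList, hk, List.take_succ_cons]
  · rw [hsend, relayedReply_of_isReport x _ (hrep I), List.map_cons]

variable {i : Fin n} (x y : PureStrategy Γ M i)

/-- The direct transcript of a player who uses `y` in the direct game, computed from her sequence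
and the transcript with the simulated mediator. -/
def directTranscript : List (Info × A) → List (S × S) → List (S × S)
  | q :: σ, p :: τ =>
    if h : Γ.owner q.1 = i then
      (y.send ⟨q.1, h⟩ (ShortList.ofList (directTranscript σ τ)),
        relayedReply x (directTranscript σ τ)
          (y.send ⟨q.1, h⟩ (ShortList.ofList (directTranscript σ τ))) (p :: τ))
        :: directTranscript σ τ
    -- Not reached in play: `infoSeq` lists only information sets of the acting player.
    else []
  | _, _ => []

/-- The strategy in the original game that has the effect of the deviation from `x` to `y` in the
direct game. -/
def relayedStrategy (hM : M.NestedRange) : PureStrategy Γ M i where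
  send I τ := relayedMessage x (directTranscript x y (Γ.infoSeq I.1) τ.1)
    (y.send I (ShortList.ofList (directTranscript x y (Γ.infoSeq I.1) τ.1))) τ.1
  act I τ := y.act I (ShortList.ofList
    -- The action is a dummy: `directTranscript` reads only the information sets of the sequence.
    (directTranscript x y ((I.1, (Γ.actionsAt_nonempty I.1).some) :: Γ.infoSeq I.1) τ.1))
  send_legal I _ := relayedMessage_legal x _ hM (y.send_legal I _)
  act_legal I _ := y.act_legal I _

lemma simulates_relayedStrategy (hM : M.NestedRange) :
    Simulates x y (relayedStrategy x y hM) (directTranscript x y) := by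
  refine ⟨by simp [directTranscript], fun I τ hl => ?_, fun I p τ hl => ?_, fun I p τ _ => ?_⟩
  · simp only [relayedStrategy, ShortList.val_ofList hl]
  · simp only [relayedStrategy, ShortList.val_ofList hl, directTranscript, dif_pos I.2]
  · simp only [directTranscript, dif_pos I.2]

end Strategies

/-! ### Mixed profiles and the equilibrium property -/

namespace Profile

variable [Fintype Info] [Fintype S]

-- A deviation as a full draw from `e` with coordinate `i` overwritten: the discarded `x i` stays
-- available, as the direct mediator still uses it.
open Classical in
lemma realization_deviate (e : Profile Γ M) (i : Fin n)
    (y : stdSimplex ℝ (PureStrategy Γ M i)) (z : List A) :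
    (e.deviate i y).realization z =
      ∑ d, e.mediator.1 d * ∑ x : ∀ i, PureStrategy Γ M i, (∏ j, (e.player j).1 (x j)) *
        ∑ b, y.1 b * if PlaysTo d (Function.update x i b) z then 1 else 0 := by
  unfold realization
  refine Finset.sum_congr rfl fun d _ => ?_
  rw [← sum_prod_update (fun j => (e.player j).1) i (e.player i).2.2 y.1
    (fun x => if PlaysTo d x z then 1 else 0), Finset.mul_sum]
  refine Finset.sum_congr rfl fun x _ => ?_
  rw [← mul_assoc]
  congr 2
  refine Finset.prod_congr rfl fun j _ => ?_
  by_cases hj : j = i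
  · subst hj
    simp [deviate]
  · simp [deviate, hj]

open Classical in
/-- The direct profile that simulates `e`. -/
def direct (e : Profile Γ M) : Profile Γ M where
  mediator := ⟨_, pushforward_mem_stdSimplex
    (mul_mem_stdSimplex e.mediator.2 (prod_mem_stdSimplex fun i => (e.player i).2))
    fun c => directMediator c.1 c.2⟩
  player i := ⟨Pi.single (directStrategy Γ M i) 1, single_mem_stdSimplex ℝ _⟩

lemma sum_direct_mediator (e : Profile Γ M) (g : PureMediator S Γ.depth → ℝ) :
    ∑ d, e.direct.mediator.1 d * g d = ∑ d, e.mediator.1 d *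
      ∑ x : ∀ i, PureStrategy Γ M i, (∏ j, (e.player j).1 (x j)) * g (directMediator d x) := by
  refine (sum_pushforward_mul _ _ _).trans ?_
  rw [Fintype.sum_prod_type]
  simp only [mul_assoc, Finset.mul_sum]

lemma realization_direct (e : Profile Γ M) {z : List A} (hz : z ∈ Γ.hist) :
    e.direct.realization z = e.realization z := by
  classical
  unfold realization
  simp only [mul_assoc, ← Finset.mul_sum]
  rw [sum_direct_mediator]
  refine Finset.sum_congr rfl fun d _ => congrArg _ <| Finset.sum_congr rfl fun x _ =>
    congrArg _ ?_
  refine (sum_prod_single (fun i => directStrategy Γ M i) _).trans ?_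
  simp only [playsTo_directMediator_iff d (fun i => ⟨_, simulates_directStrategy (x i)⟩) hz]

/-- The mixed strategy in the original game that has the effect of the deviation to `y` in the
direct game. -/
def relayedDeviation (e : Profile Γ M) (hM : M.NestedRange) {i : Fin n}
    (y : stdSimplex ℝ (PureStrategy Γ M i)) : stdSimplex ℝ (PureStrategy Γ M i) :=
  ⟨_, pushforward_mem_stdSimplex (mul_mem_stdSimplex (e.player i).2 y.2)
    fun c => relayedStrategy c.1 c.2 hM⟩

/-- The copy of `x i` held by the mediator and the one the deviator draws herself have the same law
and are independent of everything else, so they are interchangeable. -/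
lemma realization_direct_deviate (e : Profile Γ M) (hM : M.NestedRange) (i : Fin n)
    (y : stdSimplex ℝ (PureStrategy Γ M i)) {z : List A} (hz : z ∈ Γ.hist) :
    (e.direct.deviate i y).realization z
      = (e.deviate i (e.relayedDeviation hM y)).realization z := by
  classical
  rw [realization_deviate, realization_deviate, sum_direct_mediator]
  refine Finset.sum_congr rfl fun d _ => congrArg _ ?_
  have hplay : ∀ (x : ∀ i, PureStrategy Γ M i) (b : PureStrategy Γ M i),
      PlaysTo (directMediator d x) (Function.update (fun i => directStrategy Γ M i) i b) z ↔
        PlaysTo d (Function.update x i (relayedStrategy (x i) b hM)) z := by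
    intro x b
    refine playsTo_directMediator_iff d (fun j => ?_) hz
    by_cases hj : j = i
    · subst hj
      simpa using ⟨_, simulates_relayedStrategy (x j) b hM⟩
    · simpa [hj] using ⟨_, simulates_directStrategy (x j)⟩
  have hpoint : ∀ g : (∀ i, PureStrategy Γ M i) → ℝ,
      ∑ x, (∏ j, (e.direct.player j).1 (x j)) * g x = g fun i => directStrategy Γ M i :=
    fun g => sum_prod_single (fun i => directStrategy Γ M i) g
  simp only [hpoint, hplay]
  -- Redraw coordinate `i` from its own law: the fresh copy becomes the deviator's private draw.
  have hresample := sum_prod_update (fun j => (e.player j).1) i (e.player i).2.2 (e.player i).1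
    fun x => ∑ b, y.1 b *
      if PlaysTo d (Function.update x i (relayedStrategy (x i) b hM)) z then (1 : ℝ) else 0
  rw [Function.update_eq_self i fun j => (e.player j).1] at hresample
  rw [hresample]
  refine Finset.sum_congr rfl fun x _ => congrArg _ ?_
  simp only [Function.update_self, Function.update_idem]
  refine Eq.trans ?_ (sum_pushforward_mul _ _ _).symm
  rw [Fintype.sum_prod_type]
  simp only [mul_assoc, Finset.mul_sum]

lemma expectedUtility_congr {e e' : Profile Γ M} (h : e.RealizationEquivalent e') (i : Fin n) :
    e.expectedUtility i = e'.expectedUtility i :=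
  Finset.sum_congr rfl fun z hz => by rw [h z hz]

lemma realizationEquivalent_direct (e : Profile Γ M) : e.RealizationEquivalent e.direct :=
  fun _ hz => (e.realization_direct (TimedGame.mem_hist_of_mem_terminals hz)).symm

/-- The direct profile that simulates an equilibrium is a direct equilibrium. -/
lemma IsCertificationEquilibrium.direct {e : Profile Γ M} (he : e.IsCertificationEquilibrium)
    (hM : M.NestedRange) : e.direct.IsDirectEquilibrium := by
  classical
  refine ⟨fun i y => ?_, fun d hd => ?_, fun i x hx => ?_⟩
  · rw [← expectedUtility_congr e.realizationEquivalent_direct,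
      expectedUtility_congr fun z hz =>
        e.realization_direct_deviate hM i y (TimedGame.mem_hist_of_mem_terminals hz)]
    exact he i _
  · obtain ⟨c, rfl⟩ := exists_of_pushforward_ne_zero hd
    exact directMediator_direct c.1 c.2
  · obtain rfl : x = directStrategy Γ M i := by
      by_contra hne
      exact hx (Pi.single_eq_of_ne hne 1)
    exact directStrategy_direct i

end Profile

end MediatedGame

end

theorem proposition2 {n : ℕ} {A Info S : Type*} [Fintype A] [Fintype Info] [Fintype S]
    (Γ : MediatedGame.TimedGame n A Info) (M : MediatedGame.MessageSystem A Info S)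
    (hM : M.NestedRange) (e : MediatedGame.Profile Γ M) (he : e.IsCertificationEquilibrium) :
    ∃ e' : MediatedGame.Profile Γ M,
      e'.IsDirectEquilibrium ∧ e.RealizationEquivalent e' :=
  ⟨e.direct, he.direct hM, e.realizationEquivalent_direct⟩
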